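/- Let $\mathbb{B}^3$ be the closed unit ball of Euclidean space $\mathbb{E}^3$ centred at the origin. Let $K\subset\mathbb{E}^3$ have boundary $\partial K$ and interior $\operatorname{Int}(K)$. A direction $u\in\mathbb{S}^2$ illuminates a point $p\in\partial K$ with respect to $K$ if $p+\lambda u\in\operatorname{Int}(K)$ for some $\lambda>0$. For a positive integer $m$, let $I^m(K)$ be the smallest cardinality (counted with multiplicity) of a finite multiset $U$ of directions in $\mathbb{S}^2$ such that every point of $\partial K$ is illuminated with respect to $K$ by at least $m$ members of $U$ (counted with multiplicity). For a finite set $V\subset\mathbb{E}^3\setminus\mathbb{B}^3$ put $\widehat{\mathbb{B}^3}(V)=\bigcup_{v\in V}\operatorname{conv}(\mathbb{B}^3\cup\{v\})$; this is called a cap body of $\mathbb{B}^3$ if for any two distinct points $v,w\in V$ the line segment $\overline{vw}$ intersects $\mathbb{B}^3$. Let $m\ge 1$ and $n\ge 3$ be integers and let $V=\{q_1,\dots,q_n,q_{n+1}\}$, where $$q_i=\left(\sec\frac{\pi}{n}\cos\frac{2i\pi}{n},\ \sec\frac{\pi}{n}\sin\frac{2i\pi}{n},\ 0\right)\quad(i=1,\dots,n),\qquad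 q_{n+1}=\left(0,0,\sec\frac{(n-2)\pi}{2n}\right).$$ Then $V\cap\mathbb{B}^3=\emptyset$, the set $\widehat{\mathbb{B}^3}(V)$ is a cap body of $\mathbb{B}^3$, and $$I^m\left(\widehat{\mathbb{B}^3}(V)\right)=m+\left\lceil\frac{mn}{\left\lfloor\frac{n-1}{2}\right\rfloor}\right\rceil.$$ -/

import Mathlib

/-- The direction `u` illuminates the point `p` with respect to `K`: some point `p + t • u` with
`t > 0` lies in the interior of `K`. -/
def Illuminates {d : ℕ} (K : Set (EuclideanSpace ℝ (Fin d)))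
    (u : Metric.sphere (0 : EuclideanSpace ℝ (Fin d)) 1) (p : EuclideanSpace ℝ (Fin d)) : Prop :=
  ∃ q ∈ interior K, ∃ t : ℝ, 0 < t ∧ q = p + t • (u : EuclideanSpace ℝ (Fin d))

open Classical in
/-- `K` is `m`-fold illuminated by the multiset `U` of directions: each boundary point of `K` is
illuminated by at least `m` members of `U`, counted with multiplicity. -/
def IsMultiplyIlluminated {d : ℕ} (m : ℕ) (K : Set (EuclideanSpace ℝ (Fin d)))
    (U : Multiset (Metric.sphere (0 : EuclideanSpace ℝ (Fin d)) 1)) : Prop :=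
  ∀ p ∈ frontier K, m ≤ Multiset.countP (fun u => Illuminates K u p) U

/-- The `m`-fold illumination number of `K`: the smallest cardinality (with multiplicity) of a
finite multiset of directions that `m`-fold illuminates `K`, and `⊤` if there is none. -/
noncomputable def multipleIlluminationNumber {d : ℕ} (m : ℕ)
    (K : Set (EuclideanSpace ℝ (Fin d))) : ℕ∞ :=
  sInf {k : ℕ∞ | ∃ U : Multiset (Metric.sphere (0 : EuclideanSpace ℝ (Fin d)) 1),
    IsMultiplyIlluminated m K U ∧ k = (Multiset.card U : ℕ∞)}

/-- The union of the convex hulls of `K ∪ {v}`, over `v ∈ V`. -/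
def spikyBody {d : ℕ} (K V : Set (EuclideanSpace ℝ (Fin d))) : Set (EuclideanSpace ℝ (Fin d)) :=
  ⋃ v ∈ V, convexHull ℝ (K ∪ {v})

/-- The condition on `V` under which `spikyBody K V` is called a cap body of `K`: `V` is a countable
set of points outside `K`, and the segment between any two distinct points of `V` meets `K`. -/
def IsCapBodyVertexSet {d : ℕ} (K V : Set (EuclideanSpace ℝ (Fin d))) : Prop :=
  V.Countable ∧ Disjoint V K ∧
    ∀ v ∈ V, ∀ w ∈ V, v ≠ w → (segment ℝ v w ∩ K).Nonempty

/-- The closed unit ball of Euclidean `d`-space, centred at the origin. -/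
def unitBall (d : ℕ) : Set (EuclideanSpace ℝ (Fin d)) :=
  Metric.closedBall 0 1

/-- The `i`-th vertex of the regular `n`-gon in the plane `z = 0` circumscribed about the
equator of the unit ball. -/
noncomputable def equatorVertex (n i : ℕ) : EuclideanSpace ℝ (Fin 3) :=
  !₂[(1 / Real.cos (Real.pi / n)) * Real.cos (2 * i * Real.pi / n),
     (1 / Real.cos (Real.pi / n)) * Real.sin (2 * i * Real.pi / n),
     0]

/-- The point `(0, 0, sec ((n - 2) π / (2 n)))` above the north pole. -/
noncomputable def topVertex (n : ℕ) : EuclideanSpace ℝ (Fin 3) :=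
  !₂[0, 0, 1 / Real.cos (((n : ℝ) - 2) * Real.pi / (2 * n))]

/-- The `n` vertices of the regular `n`-gon, together with the point above the north pole. -/
noncomputable def equatorAndTop (n : ℕ) : Set (EuclideanSpace ℝ (Fin 3)) :=
  {q | ∃ i : ℕ, 1 ≤ i ∧ i ≤ n ∧ q = equatorVertex n i} ∪ {topVertex n}

/-! Put k = ⌊(n-1)/2⌋. Both bounds come from counting how many of the n equatorial vertices one
direction can illuminate. Lower bound. At each equatorial vertex and at the apex there are
supporting planes with opposite normals, so a direction that illuminates the apex illuminates no
equatorial vertex (`not_illuminates_equatorVertex_of_topVertex`). The two vertical supporting planes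
at an equatorial vertex reduce illumination to two signs of a sinusoid, and antiperiodicity allows
at most k vertices per direction (`card_illuminated_equatorVertex_le`). Double counting gives mn +
km ≤ k|U|. Upper bound. Take m copies of the downward direction and ⌈mn/k⌉ slightly rising
directions, the j-th aimed against the j-th block of k consecutive vertices. The blocks run around
the polygon m times. A boundary point that is not a vertex lies on a segment from a unit vector b to
a vertex, and ⟨u, b⟩ < 0 suffices for it. The downward direction serves b in the open upper
half-space and the apex; the blocks serve everything else. -/

/-! ### Spiky bodies over the ball: supporting planes and illumination criteria -/

theorem mem_convexHull_union_singleton {E : Type*} [AddCommGroup E] [Module ℝ E] {K : Set E}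
    (hK : Convex ℝ K) (hne : K.Nonempty) (v x : E) :
    x ∈ convexHull ℝ (K ∪ {v}) ↔ ∃ b ∈ K, ∃ s ∈ Set.Icc (0 : ℝ) 1, x = (1 - s) • b + s • v := by
  rw [Set.union_singleton, convexHull_insert hne, hK.convexHull_eq, mem_convexJoin]
  constructor
  · rintro ⟨a, ha, b, hb, hx⟩
    obtain rfl : a = v := ha
    rw [segment_symm, segment_eq_image] at hx
    obtain ⟨s, hs, rfl⟩ := hx
    exact ⟨b, hb, s, hs, rfl⟩
  · rintro ⟨b, hb, s, hs, rfl⟩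
    refine ⟨v, rfl, b, hb, ?_⟩
    rw [segment_symm, segment_eq_image]
    exact ⟨s, hs, rfl⟩

theorem convex_unitBall (d : ℕ) : Convex ℝ (unitBall d) :=
  convex_closedBall _ _

theorem unitBall_nonempty (d : ℕ) : (unitBall d).Nonempty :=
  ⟨0, by simp [unitBall]⟩

theorem mem_spikyBody_unitBall {d : ℕ} {V : Set (EuclideanSpace ℝ (Fin d))}
    {x : EuclideanSpace ℝ (Fin d)} :
    x ∈ spikyBody (unitBall d) V ↔
      ∃ v ∈ V, ∃ b, ‖b‖ ≤ 1 ∧ ∃ s ∈ Set.Icc (0 : ℝ) 1, x = (1 - s) • b + s • v := by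
  simp only [spikyBody, Set.mem_iUnion, exists_prop]
  refine exists_congr fun _ => and_congr_right fun _ => ?_
  rw [mem_convexHull_union_singleton (convex_unitBall d) (unitBall_nonempty d)]
  simp [unitBall]

theorem subset_spikyBody {d : ℕ} (K : Set (EuclideanSpace ℝ (Fin d)))
    {V : Set (EuclideanSpace ℝ (Fin d))} : V ⊆ spikyBody K V := fun _ hv =>
  Set.mem_biUnion hv (subset_convexHull ℝ _ (Or.inr rfl))

theorem isClosed_spikyBody_unitBall {d : ℕ} {V : Set (EuclideanSpace ℝ (Fin d))}
    (hV : V.Finite) : IsClosed (spikyBody (unitBall d) V) := by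
  refine hV.isClosed_biUnion fun v _ => ?_
  have h : convexHull ℝ (unitBall d ∪ {v}) =
      (fun p : EuclideanSpace ℝ (Fin d) × ℝ => (1 - p.2) • p.1 + p.2 • v) ''
        (unitBall d ×ˢ Set.Icc (0 : ℝ) 1) := by
    ext x
    rw [mem_convexHull_union_singleton (convex_unitBall d) (unitBall_nonempty d)]
    constructor
    · rintro ⟨b, hb, s, hs, rfl⟩
      exact ⟨(b, s), ⟨hb, hs⟩, rfl⟩
    · rintro ⟨⟨b, s⟩, ⟨hb, hs⟩, rfl⟩
      exact ⟨b, hb, s, hs, rfl⟩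
  rw [h]
  exact (((isCompact_closedBall _ _).prod isCompact_Icc).image (by fun_prop)).isClosed

/-- A half-space that contains the unit ball and the vertices contains the spiky body. -/
theorem inner_le_one_of_mem_spikyBody {d : ℕ} {V : Set (EuclideanSpace ℝ (Fin d))}
    {ν x : EuclideanSpace ℝ (Fin d)} (hν : ‖ν‖ ≤ 1) (hV : ∀ v ∈ V, inner ℝ ν v ≤ 1)
    (hx : x ∈ spikyBody (unitBall d) V) : inner ℝ ν x ≤ 1 := by
  obtain ⟨v, hv, b, hb, s, ⟨hs0, hs1⟩, rfl⟩ := mem_spikyBody_unitBall.1 hx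
  have h1 : inner ℝ ν b ≤ 1 :=
    (real_inner_le_norm ν b).trans (mul_le_one₀ hν (norm_nonneg _) hb)
  rw [inner_add_right, inner_smul_right, inner_smul_right]
  nlinarith [hV v hv, mul_le_mul_of_nonneg_left h1 (sub_nonneg.2 hs1),
    mul_le_mul_of_nonneg_left (hV v hv) hs0]

theorem inner_lt_one_of_mem_interior {d : ℕ} {K : Set (EuclideanSpace ℝ (Fin d))}
    {ν q : EuclideanSpace ℝ (Fin d)} (hK : ∀ x ∈ K, inner ℝ ν x ≤ 1)
    (hq : q ∈ interior K) : inner ℝ ν q < 1 := by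
  rcases eq_or_ne ν 0 with rfl | hν
  · simp
  -- A small push of `q` along `ν` stays in `K` and strictly increases the functional.
  have hcont : Filter.Tendsto (fun δ : ℝ => q + δ • ν) (nhdsWithin 0 (Set.Ioi 0)) (nhds q) := by
    have : Continuous (fun δ : ℝ => q + δ • ν) := by fun_prop
    simpa using (this.tendsto 0).mono_left nhdsWithin_le_nhds
  obtain ⟨δ, hδ, hδ0⟩ := ((hcont.eventually (mem_interior_iff_mem_nhds.1 hq)).and
    self_mem_nhdsWithin).exists
  have h1 := hK _ hδ
  rw [inner_add_right, inner_smul_right, real_inner_self_eq_norm_sq] at h1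
  have : 0 < δ * ‖ν‖ ^ 2 := mul_pos hδ0 (pow_pos (norm_pos_iff.2 hν) 2)
  linarith

theorem inner_neg_of_illuminates {d : ℕ} {K : Set (EuclideanSpace ℝ (Fin d))}
    {ν p : EuclideanSpace ℝ (Fin d)} {u : Metric.sphere (0 : EuclideanSpace ℝ (Fin d)) 1}
    (hK : ∀ x ∈ K, inner ℝ ν x ≤ 1) (hp : inner ℝ ν p = 1) (hu : Illuminates K u p) :
    inner ℝ ν (u : EuclideanSpace ℝ (Fin d)) < 0 := by
  obtain ⟨q, hq, t, ht, rfl⟩ := hu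
  have h := inner_lt_one_of_mem_interior hK hq
  rw [inner_add_right, inner_smul_right, hp] at h
  by_contra! hc
  nlinarith [mul_nonneg ht.le hc]

theorem mem_frontier_of_inner_eq_one {d : ℕ} {K : Set (EuclideanSpace ℝ (Fin d))}
    {ν p : EuclideanSpace ℝ (Fin d)} (hK : ∀ x ∈ K, inner ℝ ν x ≤ 1) (hp : inner ℝ ν p = 1)
    (hpK : p ∈ K) : p ∈ frontier K :=
  ⟨subset_closure hpK, fun h => (inner_lt_one_of_mem_interior hK h).ne hp⟩

/-- Points strictly between the open unit ball and a vertex are interior points. -/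
theorem mem_interior_spikyBody {d : ℕ} {V : Set (EuclideanSpace ℝ (Fin d))}
    {v b : EuclideanSpace ℝ (Fin d)} {s : ℝ} (hv : v ∈ V) (hb : ‖b‖ < 1) (hs0 : 0 ≤ s)
    (hs1 : s < 1) : (1 - s) • b + s • v ∈ interior (spikyBody (unitBall d) V) := by
  have h1 : (0 : ℝ) < 1 - s := by linarith
  refine mem_interior.2 ⟨{x | ‖(1 - s)⁻¹ • (x - s • v)‖ < 1}, fun x hx => ?_,
    isOpen_lt (by fun_prop) continuous_const, ?_⟩
  · refine mem_spikyBody_unitBall.2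
      ⟨v, hv, (1 - s)⁻¹ • (x - s • v), le_of_lt hx, s, ⟨hs0, hs1.le⟩, ?_⟩
    rw [smul_inv_smul₀ h1.ne', sub_add_cancel]
  · simpa [inv_smul_smul₀ h1.ne'] using hb

/-- The ray from `v` passes nearest to the origin at parameter -⟨u, v⟩, where its squared distance
is ‖v‖² - ⟨u, v⟩²; the hypotheses put that point in the open ball. -/
theorem illuminates_vertex {d : ℕ} {V : Set (EuclideanSpace ℝ (Fin d))}
    {v : EuclideanSpace ℝ (Fin d)} (hv : v ∈ V)
    {u : Metric.sphere (0 : EuclideanSpace ℝ (Fin d)) 1}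
    (h0 : inner ℝ (u : EuclideanSpace ℝ (Fin d)) v < 0)
    (h1 : ‖v‖ ^ 2 - 1 < (inner ℝ (u : EuclideanSpace ℝ (Fin d)) v) ^ 2) :
    Illuminates (spikyBody (unitBall d) V) u v := by
  set t : ℝ := -inner ℝ (u : EuclideanSpace ℝ (Fin d)) v with ht
  refine ⟨v + t • (u : EuclideanSpace ℝ (Fin d)), ?_, t, by linarith, rfl⟩
  have hu : ‖(u : EuclideanSpace ℝ (Fin d))‖ = 1 := by simp
  have h2 : ‖v + t • (u : EuclideanSpace ℝ (Fin d))‖ ^ 2 < 1 := by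
    rw [norm_add_sq_real, norm_smul, hu, inner_smul_right, real_inner_comm, mul_one,
      Real.norm_eq_abs, sq_abs, ht]
    linarith
  have := mem_interior_spikyBody (s := 0) hv (by nlinarith [norm_nonneg (v + t • (u : EuclideanSpace ℝ (Fin d)))] :
    ‖v + t • (u : EuclideanSpace ℝ (Fin d))‖ < 1) le_rfl one_pos
  simpa using this

/-- Moving `b` along `u` into the open ball, with `v` fixed, moves the point of the segment parallel
to `u` into the interior. -/
theorem illuminates_of_inner_neg {d : ℕ} {V : Set (EuclideanSpace ℝ (Fin d))}
    {v b : EuclideanSpace ℝ (Fin d)} {s : ℝ} (hv : v ∈ V) (hb : ‖b‖ = 1) (hs0 : 0 ≤ s)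
    (hs1 : s < 1) {u : Metric.sphere (0 : EuclideanSpace ℝ (Fin d)) 1}
    (h0 : inner ℝ (u : EuclideanSpace ℝ (Fin d)) b < 0) :
    Illuminates (spikyBody (unitBall d) V) u ((1 - s) • b + s • v) := by
  set t : ℝ := -inner ℝ (u : EuclideanSpace ℝ (Fin d)) b with ht
  have hu : ‖(u : EuclideanSpace ℝ (Fin d))‖ = 1 := by simp
  have h2 : ‖b + t • (u : EuclideanSpace ℝ (Fin d))‖ ^ 2 < 1 := by
    rw [norm_add_sq_real, norm_smul, hu, inner_smul_right, real_inner_comm, mul_one,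
      Real.norm_eq_abs, sq_abs, ht, hb]
    nlinarith
  refine ⟨(1 - s) • (b + t • (u : EuclideanSpace ℝ (Fin d))) + s • v,
    mem_interior_spikyBody hv ?_ hs0 hs1, (1 - s) * t,
    mul_pos (by linarith) (by linarith), ?_⟩
  · nlinarith [norm_nonneg (b + t • (u : EuclideanSpace ℝ (Fin d)))]
  · rw [smul_add, smul_smul]
    abel

/-- A frontier point of a spiky body is a vertex, or lies on a half-open segment from a point of
the unit sphere to a vertex. -/
theorem exists_of_mem_frontier_spikyBody {d : ℕ} {V : Set (EuclideanSpace ℝ (Fin d))}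
    (hV : V.Finite) {p : EuclideanSpace ℝ (Fin d)}
    (hp : p ∈ frontier (spikyBody (unitBall d) V)) :
    p ∈ V ∨ ∃ v ∈ V, ∃ b, ‖b‖ = 1 ∧ ∃ s : ℝ, 0 ≤ s ∧ s < 1 ∧ p = (1 - s) • b + s • v := by
  obtain ⟨v, hv, b, hb, s, ⟨hs0, hs1⟩, rfl⟩ :=
    mem_spikyBody_unitBall.1 ((isClosed_spikyBody_unitBall hV).frontier_subset hp)
  rcases hs1.eq_or_lt with rfl | hs1
  · left
    simpa using hv
  · rcases hb.eq_or_lt with hb | hb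
    · exact Or.inr ⟨v, hv, b, hb, s, hs0, hs1, rfl⟩
    · exact absurd (mem_interior_spikyBody hv hb hs0 hs1) hp.2

/-! ### Counting on the cycle ℤ/n -/

/-- The translate of `C` by `h` avoids `T`, so |C| + |T| ≤ n. A nonempty `C` is a proper subset of
`T`, since otherwise `S` would be closed under predecessors and hold everywhere, against `hS`. The
strict inclusion gains the 1 in n - 1. -/
theorem card_consecutive_le {n : ℕ} [NeZero n] (S : ZMod n → Prop) [DecidablePred S] (h : ZMod n)
    (hS : ∀ i, S i → S (i - 1) → ¬ S (i + h)) :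
    2 * (Finset.univ.filter fun i => S i ∧ S (i - 1)).card ≤ n - 1 := by
  set C := Finset.univ.filter fun i => S i ∧ S (i - 1) with hC
  set T := Finset.univ.filter S with hT
  have hn : 0 < n := Nat.pos_of_neZero n
  have hCT : C ⊆ T := fun i hi => by
    simp only [hC, hT, Finset.mem_filter] at hi ⊢
    exact ⟨hi.1, hi.2.1⟩
  have hdisj : Disjoint (C.map (addRightEmbedding h)) T := by
    rw [Finset.disjoint_left]
    intro x hx hxT
    obtain ⟨i, hi, rfl⟩ := Finset.mem_map.1 hx
    simp only [hC, hT, Finset.mem_filter, Finset.mem_univ, true_and] at hi hxT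
    exact hS i hi.1 hi.2 hxT
  have hsum : C.card + T.card ≤ n := by
    have := Finset.card_le_univ (C.map (addRightEmbedding h) ∪ T)
    rwa [Finset.card_union_of_disjoint hdisj, Finset.card_map, ZMod.card] at this
  rcases C.eq_empty_or_nonempty with h0 | ⟨i, hi⟩
  · simp [h0]
  have hne : C ≠ T := by
    intro heq
    have hstep : ∀ j, S j → S (j - 1) := fun j hj => by
      have : j ∈ C := heq ▸ (by simpa [hT] using hj)
      simp only [hC, Finset.mem_filter] at this
      exact this.2.2
    simp only [hC, Finset.mem_filter, Finset.mem_univ, true_and] at hi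
    have hall : ∀ k : ℕ, S (i - k) := by
      intro k
      induction k with
      | zero => simpa using hi.1
      | succ k ih =>
        have := hstep _ ih
        rwa [sub_sub, ← Nat.cast_succ] at this
    refine hS i hi.1 hi.2 ?_
    have := hall (-h).val
    rwa [ZMod.natCast_zmod_val, sub_neg_eq_add] at this
  have := Finset.card_lt_card (Finset.ssubset_iff_subset_ne.2 ⟨hCT, hne⟩)
  omega

/-- A sinusoid changes sign under a half turn, so two adjacent negative values exclude one at the
shift by ⌊n/2⌋. For even n this shift is exactly a half turn; for odd n it lands opposite the
midpoint of the two values, where `g` is also negative. -/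
theorem card_consecutive_neg_le {n : ℕ} (hn : 3 ≤ n) (a b : ℝ) (g : ℝ → ℝ)
    (hg : ∀ x, g x = a * Real.cos (x * (Real.pi / n)) + b * Real.sin (x * (Real.pi / n))) :
    ((Finset.Icc 1 n).filter fun i : ℕ =>
      g (2 * i + 1) < 0 ∧ g (2 * i - 1) < 0).card ≤ (n - 1) / 2 := by
  classical
  have : NeZero n := ⟨by omega⟩
  have hn0 : (n : ℝ) ≠ 0 := by positivity
  have hper : ∀ (x : ℝ) (z : ℤ), g (x + 2 * (z * n)) = g x := by
    intro x z
    have : (x + 2 * (z * n)) * (Real.pi / n) = x * (Real.pi / n) + z * (2 * Real.pi) := by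
      field_simp
    rw [hg, hg, this, Real.cos_add_int_mul_two_pi, Real.sin_add_int_mul_two_pi]
  have hanti : ∀ x : ℝ, g (x + n) = -g x := by
    intro x
    have : (x + n) * (Real.pi / n) = x * (Real.pi / n) + Real.pi := by field_simp
    rw [hg, hg, this, Real.cos_add_pi, Real.sin_add_pi]
    ring
  have hmid : ∀ x : ℝ, g (x + 1) + g (x - 1) = 2 * Real.cos (Real.pi / n) * g x := by
    intro x
    simp only [hg, add_mul, sub_mul, one_mul, Real.cos_add, Real.sin_add, Real.cos_sub,
      Real.sin_sub]
    ring
  have hcos : 0 < Real.cos (Real.pi / n) := by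
    apply Real.cos_pos_of_mem_Ioo
    have h3 : (3 : ℝ) ≤ n := by exact_mod_cast hn
    have h1 : Real.pi / n < Real.pi / 2 :=
      div_lt_div_of_pos_left Real.pi_pos (by norm_num) (by linarith)
    constructor
    · have : 0 < Real.pi / n := by positivity
      linarith [Real.pi_pos]
    · exact h1
  -- `S i` is the sign at the edge following vertex i; periodicity makes it independent of the
  -- representative.
  let S : ZMod n → Prop := fun x => g (2 * ((x.cast : ℤ) : ℝ) + 1) < 0
  have hScast : ∀ z : ℤ, S (z : ZMod n) ↔ g (2 * (z : ℝ) + 1) < 0 := by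
    intro z
    have h1 : (((z : ZMod n).cast : ℤ) : ℝ) = z - (z / n : ℤ) * n := by
      rw [ZMod.coe_intCast, Int.emod_def]
      push_cast
      ring
    have h2 : (2 * (z : ℝ) + 1) = 2 * (z - (z / n : ℤ) * n) + 1 + 2 * ((z / n : ℤ) * n) := by ring
    simp only [S]
    rw [h1, h2, hper]
  have hkey : ∀ z : ℤ, g (2 * (z : ℝ) + 1) < 0 → g (2 * (z : ℝ) - 1) < 0 →
      ¬ g (2 * ((z + (n / 2 : ℕ) : ℤ) : ℝ) + 1) < 0 := by
    intro z h1 h2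
    rcases Nat.even_or_odd' n with ⟨h, hh | hh⟩
    · have h3 : (2 * ((z + (n / 2 : ℕ) : ℤ) : ℝ) + 1) = (2 * z + 1) + n := by
        have : n / 2 = h := by omega
        rw [this]
        have : (n : ℝ) = 2 * h := by exact_mod_cast hh
        rw [this]
        push_cast
        ring
      rw [h3, hanti]
      linarith
    · have h3 : (2 * ((z + (n / 2 : ℕ) : ℤ) : ℝ) + 1) = (2 * z) + n := by
        have : n / 2 = h := by omega
        rw [this]
        have : (n : ℝ) = 2 * h + 1 := by exact_mod_cast hh
        rw [this]
        push_cast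
        ring
      rw [h3, hanti]
      have := hmid (2 * z)
      have h4 : g (2 * z) < 0 := by
        by_contra! hc
        have := mul_nonneg (mul_nonneg zero_le_two hcos.le) hc
        linarith
      linarith
  have hC := card_consecutive_le S ((n / 2 : ℕ) : ZMod n) (by
    intro i
    have hi : ((i.cast : ℤ) : ZMod n) = i := ZMod.intCast_zmod_cast i
    generalize (i.cast : ℤ) = z at hi
    subst hi
    have e1 : (z : ZMod n) - 1 = ((z - 1 : ℤ) : ZMod n) := by push_cast; rfl
    have e2 : (z : ZMod n) + ((n / 2 : ℕ) : ZMod n) = ((z + (n / 2 : ℕ) : ℤ) : ZMod n) := by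
      rw [Int.cast_add, Int.cast_natCast]
    rw [e1, e2, hScast, hScast, hScast]
    intro h1 h2
    refine hkey z h1 ?_
    convert h2 using 2
    push_cast
    ring)
  have hle : ((Finset.Icc 1 n).filter fun i : ℕ =>
      g (2 * i + 1) < 0 ∧ g (2 * i - 1) < 0).card ≤
      (Finset.univ.filter fun i => S i ∧ S (i - 1)).card := by
    refine Finset.card_le_card_of_injOn (fun i : ℕ => (i : ZMod n)) ?_ ?_
    · intro i hi
      simp only [Finset.coe_filter, Set.mem_ofPred_eq, Finset.mem_univ, true_and] at hi ⊢
      have e1 : (i : ZMod n) - 1 = ((i - 1 : ℤ) : ZMod n) := by push_cast; rfl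
      have e2 : (i : ZMod n) = ((i : ℤ) : ZMod n) := by push_cast; rfl
      rw [e1, e2, hScast, hScast]
      refine ⟨by simpa using hi.2.1, ?_⟩
      convert hi.2.2 using 2
      push_cast
      ring
    · intro i hi j hj hij
      simp only [Finset.coe_filter, Set.mem_ofPred_eq, Finset.mem_Icc] at hi hj
      have := (ZMod.natCast_eq_natCast_iff' _ _ _).1 hij
      rcases hi.1.2.eq_or_lt with h1 | h1 <;> rcases hj.1.2.eq_or_lt with h2 | h2
      · omega
      · rw [h1, Nat.mod_self, Nat.mod_eq_of_lt h2] at this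
        omega
      · rw [h2, Nat.mod_self, Nat.mod_eq_of_lt h1] at this
        omega
      · rwa [Nat.mod_eq_of_lt h1, Nat.mod_eq_of_lt h2] at this
  omega

/-- Consecutive blocks of length `k` in `ℤ / n`, long enough to go round `m` times, cover each
residue at least `m` times. -/
theorem le_card_blocks {k n N m : ℕ} (hk : 0 < k) (hkn : k ≤ n) (hN : m * n ≤ k * N) (i : ℤ)
    [DecidablePred fun j : ℕ => ∃ l < k, ∃ z : ℤ, i + z * n = j * k + l] :
    m ≤ ((Finset.range N).filter fun j : ℕ => ∃ l < k, ∃ z : ℤ, i + z * n = j * k + l).card := by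
  have hn : 0 < n := hk.trans_le hkn
  have hr0 : 0 ≤ i % n := Int.emod_nonneg _ (by omega)
  have hrn : i % n < n := Int.emod_lt_of_pos _ (by omega)
  obtain ⟨r, hr⟩ := Int.eq_ofNat_of_zero_le hr0
  have hr' : r < n := by omega
  rw [← Finset.card_range m]
  -- The t-th lift r + tn of the residue lies in block (r + tn)/k; lifts are n ≥ k apart, so their
  -- blocks differ.
  refine Finset.card_le_card_of_injOn (fun t => (r + t * n) / k) ?_ ?_
  · intro t ht
    simp only [Finset.coe_range, Set.mem_Iio] at ht
    simp only [Finset.coe_filter, Finset.mem_range, Set.mem_ofPred_eq]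
    refine ⟨(Nat.div_lt_iff_lt_mul hk).2 ?_, (r + t * n) % k, Nat.mod_lt _ hk, t - i / n, ?_⟩
    · rw [mul_comm N]
      refine lt_of_lt_of_le ?_ hN
      nlinarith
    · have h1 : (((r + t * n) / k : ℕ) : ℤ) * k + ((r + t * n) % k : ℕ) = r + t * n := by
        exact_mod_cast Nat.div_add_mod' (r + t * n) k
      rw [h1]
      have := Int.emod_add_mul_ediv i n
      linarith
  · have hmono : StrictMono fun t : ℕ => (r + t * n) / k := by
      refine strictMono_nat_of_lt_succ fun t => ?_
      calc (r + t * n) / k < (r + t * n + k) / k := by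
            rw [Nat.add_div_right _ hk]
            exact Nat.lt_succ_self _
        _ ≤ (r + (t + 1) * n) / k := Nat.div_le_div_right (by linarith)
    exact hmono.injective.injOn

-- Each member of `U` adds at most `k` to the left side: either through the `P i`, or through `Q`
-- alone.
open Classical in
theorem sum_countP_add_mul_countP_le {α ι : Type*} (s : Finset ι) (P : ι → α → Prop)
    (Q : α → Prop) (k : ℕ) (hP : ∀ u, (s.filter fun i => P i u).card ≤ k)
    (hQ : ∀ u, Q u → ∀ i ∈ s, ¬ P i u) (U : Multiset α) :
    ∑ i ∈ s, U.countP (P i) + k * U.countP Q ≤ k * Multiset.card U := by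
  induction U using Multiset.induction_on with
  | empty => simp
  | cons u U ih =>
    simp only [Multiset.countP_cons, Finset.sum_add_distrib, Multiset.card_cons, mul_add]
    rw [← Finset.card_filter]
    have h : (s.filter fun i => P i u).card + k * (if Q u then 1 else 0) ≤ k * 1 := by
      split_ifs with hu
      · rw [Finset.card_eq_zero.2 (Finset.filter_eq_empty_iff.2 fun i hi => hQ u hu i hi)]
        omega
      · simpa using hP u
    omega

/-! ### Trigonometry and coordinates of the vertices -/

theorem cos_le_cos_of_abs_le {x y : ℝ} (h : |x| ≤ y) (hy : y ≤ Real.pi) :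
    Real.cos y ≤ Real.cos x := by
  rw [← Real.cos_abs x]
  exact Real.cos_le_cos_of_nonneg_of_le_pi (abs_nonneg x) hy h

/-- An odd number has a remainder between 1 and 2n - 1 modulo 2n, so the angle stays at least π/n
away from every multiple of 2π. -/
theorem cos_odd_mul_le {n : ℕ} (hn : 1 ≤ n) (z : ℤ) :
    Real.cos ((2 * z + 1) * (Real.pi / n)) ≤ Real.cos (Real.pi / n) := by
  have hn0 : (0 : ℝ) < n := by exact_mod_cast hn
  have hpos : 0 < Real.pi / n := by positivity
  have hnpi : n * (Real.pi / n) = Real.pi := by field_simp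
  set w := (2 * z + 1) / (2 * n) with hw
  set r := (2 * z + 1) % (2 * n) with hr
  have h1 : 2 * z + 1 = r + 2 * n * w := by rw [hr, hw, Int.emod_add_mul_ediv]
  have h2 : 0 ≤ r := Int.emod_nonneg _ (by omega)
  have h3 : r < 2 * n := Int.emod_lt_of_pos _ (by omega)
  have h4 : 1 ≤ r := by
    rcases h2.eq_or_lt with h | h
    · rw [← h] at h1
      have : 2 * (n * w) = 2 * z + 1 := by linarith
      omega
    · omega
  have h5 : ((2 : ℝ) * z + 1) = r + 2 * n * w := by exact_mod_cast h1
  have h6 : ((2 : ℝ) * z + 1) * (Real.pi / n) = r * (Real.pi / n) + w * (2 * Real.pi) := by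
    rw [h5]
    linear_combination 2 * (w : ℝ) * hnpi
  rw [h6, Real.cos_add_int_mul_two_pi]
  have h4' : (1 : ℝ) ≤ r := by exact_mod_cast h4
  have h3' : (r : ℝ) ≤ 2 * n - 1 := by
    have : r ≤ 2 * n - 1 := by omega
    exact_mod_cast this
  rcases le_total (r : ℝ) n with hle | hle
  · exact Real.cos_le_cos_of_nonneg_of_le_pi hpos.le (by nlinarith) (by nlinarith)
  · rw [← Real.cos_two_pi_sub]
    exact Real.cos_le_cos_of_nonneg_of_le_pi hpos.le (by nlinarith) (by nlinarith)

theorem inner_eq_three (x y : EuclideanSpace ℝ (Fin 3)) :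
    inner ℝ x y = x 0 * y 0 + x 1 * y 1 + x 2 * y 2 := by
  simp only [PiLp.inner_apply, Fin.sum_univ_three, RCLike.inner_apply, conj_trivial]
  ring

theorem norm_sq_eq_three (x : EuclideanSpace ℝ (Fin 3)) :
    ‖x‖ ^ 2 = x 0 ^ 2 + x 1 ^ 2 + x 2 ^ 2 := by
  rw [← real_inner_self_eq_norm_sq, inner_eq_three]
  ring

theorem norm_le_one_of_sq {x : EuclideanSpace ℝ (Fin 3)} (h : x 0 ^ 2 + x 1 ^ 2 + x 2 ^ 2 ≤ 1) :
    ‖x‖ ≤ 1 := by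
  rw [← norm_sq_eq_three] at h
  exact (sq_le_one_iff₀ (norm_nonneg x)).1 h

theorem norm_eq_one_of_sq {x : EuclideanSpace ℝ (Fin 3)} (h : x 0 ^ 2 + x 1 ^ 2 + x 2 ^ 2 = 1) :
    ‖x‖ = 1 := by
  rw [← norm_sq_eq_three] at h
  exact (pow_eq_one_iff_of_nonneg (norm_nonneg x) two_ne_zero).1 h

theorem pi_div_pos {n : ℕ} (hn : 3 ≤ n) : 0 < Real.pi / n := by
  have : (0 : ℝ) < n := by exact_mod_cast (by omega : 0 < n)
  have := Real.pi_pos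
  positivity

theorem pi_div_lt {n : ℕ} (hn : 3 ≤ n) : Real.pi / n < Real.pi / 2 := by
  have h3 : (3 : ℝ) ≤ n := by exact_mod_cast hn
  exact div_lt_div_of_pos_left Real.pi_pos (by norm_num) (by linarith)

theorem cos_pi_div_pos {n : ℕ} (hn : 3 ≤ n) : 0 < Real.cos (Real.pi / n) :=
  Real.cos_pos_of_mem_Ioo ⟨by linarith [pi_div_pos hn, Real.pi_pos], pi_div_lt hn⟩

theorem sin_pi_div_pos {n : ℕ} (hn : 3 ≤ n) : 0 < Real.sin (Real.pi / n) :=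
  Real.sin_pos_of_pos_of_lt_pi (pi_div_pos hn) (by linarith [pi_div_lt hn, Real.pi_pos])

theorem cos_top_angle {n : ℕ} (hn : 3 ≤ n) :
    Real.cos (((n : ℝ) - 2) * Real.pi / (2 * n)) = Real.sin (Real.pi / n) := by
  have : (n : ℝ) ≠ 0 := by positivity
  rw [← Real.cos_pi_div_two_sub]
  congr 1
  field_simp

theorem equatorVertex_eq (n i : ℕ) : equatorVertex n i =
    !₂[Real.cos ((2 * i) * (Real.pi / n)) / Real.cos (Real.pi / n),
      Real.sin ((2 * i) * (Real.pi / n)) / Real.cos (Real.pi / n), 0] := by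
  simp only [equatorVertex, one_div_mul_eq_div, mul_div_assoc]

theorem topVertex_eq {n : ℕ} (hn : 3 ≤ n) :
    topVertex n = !₂[0, 0, 1 / Real.sin (Real.pi / n)] := by
  rw [topVertex, cos_top_angle hn]

theorem inner_equatorVertex (n i : ℕ) (x : EuclideanSpace ℝ (Fin 3)) :
    inner ℝ x (equatorVertex n i) = (x 0 * Real.cos ((2 * i) * (Real.pi / n)) +
      x 1 * Real.sin ((2 * i) * (Real.pi / n))) / Real.cos (Real.pi / n) := by
  rw [equatorVertex_eq, inner_eq_three]
  simp
  ring

theorem inner_topVertex {n : ℕ} (hn : 3 ≤ n) (x : EuclideanSpace ℝ (Fin 3)) :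
    inner ℝ x (topVertex n) = x 2 / Real.sin (Real.pi / n) := by
  rw [topVertex_eq hn, inner_eq_three]
  simp
  rfl

theorem norm_sq_equatorVertex (n i : ℕ) :
    ‖equatorVertex n i‖ ^ 2 = 1 / Real.cos (Real.pi / n) ^ 2 := by
  rw [equatorVertex_eq, norm_sq_eq_three]
  simp only [Matrix.cons_val, div_pow, Matrix.cons_val_zero, Matrix.cons_val_one]
  rw [← add_div, Real.cos_sq_add_sin_sq]
  simp

theorem equatorVertex_mem {n i : ℕ} (hi : i ∈ Finset.Icc 1 n) :
    equatorVertex n i ∈ equatorAndTop n :=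
  Or.inl ⟨i, (Finset.mem_Icc.1 hi).1, (Finset.mem_Icc.1 hi).2, rfl⟩

theorem topVertex_mem (n : ℕ) : topVertex n ∈ equatorAndTop n := Or.inr rfl

theorem equatorAndTop_finite (n : ℕ) : (equatorAndTop n).Finite := by
  refine Set.Finite.union (((Finset.Icc 1 n).finite_toSet.image (equatorVertex n)).subset ?_)
    (Set.finite_singleton _)
  rintro _ ⟨i, h1, h2, rfl⟩
  exact ⟨i, by simpa using ⟨h1, h2⟩, rfl⟩

theorem forall_mem_equatorAndTop {n : ℕ} {P : EuclideanSpace ℝ (Fin 3) → Prop}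
    (h : ∀ i ∈ Finset.Icc 1 n, P (equatorVertex n i)) (ht : P (topVertex n)) :
    ∀ v ∈ equatorAndTop n, P v := by
  rintro v (⟨i, h1, h2, rfl⟩ | rfl)
  · exact h i (Finset.mem_Icc.2 ⟨h1, h2⟩)
  · exact ht

/-! ### The cap body condition -/

theorem segment_equatorVertex_inter {n : ℕ} (hn : 3 ≤ n) {i j : ℕ} (hi : i ∈ Finset.Icc 1 n)
    (hj : j ∈ Finset.Icc 1 n) (hij : i ≠ j) :
    (segment ℝ (equatorVertex n i) (equatorVertex n j) ∩ unitBall 3).Nonempty := by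
  have hc := cos_pi_div_pos hn
  have hp := pi_div_pos hn
  have hnpi : n * (Real.pi / n) = Real.pi := by field_simp
  refine ⟨(1 / 2 : ℝ) • equatorVertex n i + (1 / 2 : ℝ) • equatorVertex n j,
    ⟨1 / 2, 1 / 2, by norm_num, by norm_num, by norm_num, rfl⟩, ?_⟩
  rw [unitBall, mem_closedBall_zero_iff]
  -- The midpoint has squared norm (1 + cos δ) / (2 cos²(π/n)), δ being the angle between the
  -- vertices, so δ at least 2π/n modulo full turns is what is needed.
  have key : Real.cos (2 * ((i : ℝ) - j) * (Real.pi / n)) ≤ Real.cos (2 * (Real.pi / n)) := by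
    wlog h : j < i generalizing i j
    · have := this hj hi hij.symm (by omega)
      rw [← Real.cos_neg]
      convert this using 2
      ring
    rw [Finset.mem_Icc] at hi hj
    have h1 : (j : ℝ) + 1 ≤ i := by exact_mod_cast h
    have h2 : (i : ℝ) + 1 ≤ n + j := by exact_mod_cast (by omega : i + 1 ≤ n + j)
    rcases le_total (2 * ((i : ℝ) - j)) n with h3 | h3
    · exact Real.cos_le_cos_of_nonneg_of_le_pi (by linarith) (by nlinarith) (by nlinarith)
    · rw [← Real.cos_two_pi_sub]
      exact Real.cos_le_cos_of_nonneg_of_le_pi (by linarith) (by nlinarith) (by nlinarith)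
  refine (sq_le_one_iff₀ (norm_nonneg _)).1 ?_
  rw [norm_add_sq_real, norm_smul, norm_smul, inner_smul_left, inner_smul_right,
    inner_equatorVertex, mul_pow, mul_pow, norm_sq_equatorVertex, norm_sq_equatorVertex,
    equatorVertex_eq]
  rw [Real.cos_two_mul] at key
  have e : Real.cos (2 * ((i : ℝ) - j) * (Real.pi / n)) =
      Real.cos (2 * i * (Real.pi / n)) * Real.cos (2 * j * (Real.pi / n)) +
      Real.sin (2 * i * (Real.pi / n)) * Real.sin (2 * j * (Real.pi / n)) := by
    rw [← Real.cos_sub]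
    ring_nf
  rw [e] at key
  generalize 2 * (i : ℝ) * (Real.pi / n) = A at key ⊢
  generalize 2 * (j : ℝ) * (Real.pi / n) = B at key ⊢
  simp only [Matrix.cons_val_zero, Matrix.cons_val_one]
  norm_num
  field_simp
  linarith

theorem segment_equatorVertex_topVertex_inter {n : ℕ} (hn : 3 ≤ n) (i : ℕ) :
    (segment ℝ (equatorVertex n i) (topVertex n) ∩ unitBall 3).Nonempty := by
  have hc := cos_pi_div_pos hn
  have hs := sin_pi_div_pos hn
  -- These weights give the unit vector at elevation π/n above vertex i, where the segment touches
  -- the sphere.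
  refine ⟨Real.cos (Real.pi / n) ^ 2 • equatorVertex n i + Real.sin (Real.pi / n) ^ 2 • topVertex n,
    ⟨_, _, sq_nonneg _, sq_nonneg _, Real.cos_sq_add_sin_sq _, rfl⟩, ?_⟩
  rw [unitBall, mem_closedBall_zero_iff]
  apply norm_le_one_of_sq
  rw [equatorVertex_eq, topVertex_eq hn]
  generalize 2 * (i : ℝ) * (Real.pi / n) = A
  simp
  field_simp
  rw [Real.cos_sq_add_sin_sq, mul_one, Real.cos_sq_add_sin_sq]

theorem isCapBodyVertexSet_equatorAndTop {n : ℕ} (hn : 3 ≤ n) :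
    IsCapBodyVertexSet (unitBall 3) (equatorAndTop n) := by
  have hc := cos_pi_div_pos hn
  have hs := sin_pi_div_pos hn
  have hsc := Real.cos_sq_add_sin_sq (Real.pi / n)
  refine ⟨(equatorAndTop_finite n).countable, ?_, ?_⟩
  · rw [Set.disjoint_left]
    simp only [unitBall, mem_closedBall_zero_iff, not_le]
    refine forall_mem_equatorAndTop (fun i _ => ?_) ?_
    · refine (one_lt_sq_iff₀ (norm_nonneg _)).1 ?_
      rw [norm_sq_equatorVertex, lt_div_iff₀ (by positivity)]
      nlinarith
    · refine (one_lt_sq_iff₀ (norm_nonneg _)).1 ?_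
      rw [topVertex_eq hn, norm_sq_eq_three]
      simp
      refine (one_lt_inv₀ (by positivity)).2 (by nlinarith)
  · rintro v (⟨i, hi, hi', rfl⟩ | rfl) w (⟨j, hj, hj', rfl⟩ | rfl) hvw
    · exact segment_equatorVertex_inter hn (Finset.mem_Icc.2 ⟨hi, hi'⟩)
        (Finset.mem_Icc.2 ⟨hj, hj'⟩) (by rintro rfl; exact hvw rfl)
    · exact segment_equatorVertex_topVertex_inter hn i
    · rw [segment_symm]
      exact segment_equatorVertex_topVertex_inter hn j
    · exact absurd rfl hvw

/-! ### Lower bound -/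

/-- The equatorial unit vector at angle `x * π / n`. -/
noncomputable def equatorDir (n : ℕ) (x : ℝ) : EuclideanSpace ℝ (Fin 3) :=
  !₂[Real.cos (x * (Real.pi / n)), Real.sin (x * (Real.pi / n)), 0]

/-- The common unit normal, up to sign, of the spiky body at the `i`-th equator vertex and at the
top vertex. -/
noncomputable def tiltedDir (n i : ℕ) : EuclideanSpace ℝ (Fin 3) :=
  !₂[Real.cos (Real.pi / n) * Real.cos ((2 * i) * (Real.pi / n)),
    Real.cos (Real.pi / n) * Real.sin ((2 * i) * (Real.pi / n)), -Real.sin (Real.pi / n)]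

theorem norm_equatorDir (n : ℕ) (x : ℝ) : ‖equatorDir n x‖ = 1 := by
  apply norm_eq_one_of_sq
  simp [equatorDir]

theorem norm_tiltedDir (n i : ℕ) : ‖tiltedDir n i‖ = 1 := by
  apply norm_eq_one_of_sq
  simp [tiltedDir]
  linear_combination Real.cos (Real.pi / n) ^ 2 * Real.cos_sq_add_sin_sq (2 * i * (Real.pi / n)) +
    Real.cos_sq_add_sin_sq (Real.pi / n)

theorem inner_equatorDir_equatorVertex (n i : ℕ) (x : ℝ) :
    inner ℝ (equatorDir n x) (equatorVertex n i) =
      Real.cos ((x - 2 * i) * (Real.pi / n)) / Real.cos (Real.pi / n) := by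
  rw [inner_equatorVertex, sub_mul, Real.cos_sub]
  simp [equatorDir]

theorem inner_equatorDir_le_one {n : ℕ} (hn : 3 ≤ n) (z : ℤ) :
    ∀ v ∈ spikyBody (unitBall 3) (equatorAndTop n), inner ℝ (equatorDir n (2 * z + 1)) v ≤ 1 := by
  intro v hv
  refine inner_le_one_of_mem_spikyBody (norm_equatorDir n _).le ?_ hv
  refine forall_mem_equatorAndTop (fun i _ => ?_) ?_
  · rw [inner_equatorDir_equatorVertex, div_le_one (cos_pi_div_pos hn)]
    have h := cos_odd_mul_le (by omega : 1 ≤ n) (z - i)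
    rw [Int.cast_sub, Int.cast_natCast] at h
    rwa [show (2 * (z : ℝ) + 1 - 2 * i) = 2 * (z - i) + 1 by ring]
  · rw [inner_topVertex hn]
    simp [equatorDir]

theorem inner_tiltedDir_equatorVertex {n : ℕ} (hn : 3 ≤ n) (i j : ℕ) :
    inner ℝ (tiltedDir n i) (equatorVertex n j) =
      Real.cos (2 * i * (Real.pi / n) - 2 * j * (Real.pi / n)) := by
  have hc := cos_pi_div_pos hn
  rw [inner_equatorVertex, Real.cos_sub]
  simp [tiltedDir]
  field_simp

theorem inner_tiltedDir_topVertex {n : ℕ} (hn : 3 ≤ n) (i : ℕ) :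
    inner ℝ (tiltedDir n i) (topVertex n) = -1 := by
  have hs := sin_pi_div_pos hn
  rw [inner_topVertex hn]
  simp [tiltedDir, hs.ne']

theorem inner_tiltedDir_le_one {n : ℕ} (hn : 3 ≤ n) (i : ℕ) :
    ∀ v ∈ spikyBody (unitBall 3) (equatorAndTop n), inner ℝ (tiltedDir n i) v ≤ 1 := by
  intro v hv
  refine inner_le_one_of_mem_spikyBody (norm_tiltedDir n i).le ?_ hv
  refine forall_mem_equatorAndTop (fun j _ => ?_) ?_
  · rw [inner_tiltedDir_equatorVertex hn]
    exact Real.cos_le_one _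
  · rw [inner_tiltedDir_topVertex hn]
    norm_num

theorem inner_neg_tiltedDir_le_one {n : ℕ} (hn : 3 ≤ n) (i : ℕ) :
    ∀ v ∈ spikyBody (unitBall 3) (equatorAndTop n), inner ℝ (-tiltedDir n i) v ≤ 1 := by
  intro v hv
  refine inner_le_one_of_mem_spikyBody (by rw [norm_neg, norm_tiltedDir]) ?_ hv
  refine forall_mem_equatorAndTop (fun j _ => ?_) ?_
  · rw [inner_neg_left, inner_tiltedDir_equatorVertex hn]
    linarith [Real.neg_one_le_cos (2 * i * (Real.pi / n) - 2 * j * (Real.pi / n))]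
  · rw [inner_neg_left, inner_tiltedDir_topVertex hn, neg_neg]

theorem not_illuminates_equatorVertex_of_topVertex {n : ℕ} (hn : 3 ≤ n) (i : ℕ)
    {u : Metric.sphere (0 : EuclideanSpace ℝ (Fin 3)) 1}
    (hu : Illuminates (spikyBody (unitBall 3) (equatorAndTop n)) u (topVertex n)) :
    ¬ Illuminates (spikyBody (unitBall 3) (equatorAndTop n)) u (equatorVertex n i) := by
  intro hi
  have h1 := inner_neg_of_illuminates (inner_neg_tiltedDir_le_one hn i)
    (by rw [inner_neg_left, inner_tiltedDir_topVertex hn, neg_neg]) hu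
  have h2 := inner_neg_of_illuminates (inner_tiltedDir_le_one hn i)
    (by rw [inner_tiltedDir_equatorVertex hn, sub_self, Real.cos_zero]) hi
  rw [inner_neg_left] at h1
  linarith

theorem equatorVertex_mem_frontier {n i : ℕ} (hn : 3 ≤ n) (hi : i ∈ Finset.Icc 1 n) :
    equatorVertex n i ∈ frontier (spikyBody (unitBall 3) (equatorAndTop n)) :=
  mem_frontier_of_inner_eq_one (inner_tiltedDir_le_one hn i)
    (by rw [inner_tiltedDir_equatorVertex hn, sub_self, Real.cos_zero])
    (subset_spikyBody _ (equatorVertex_mem hi))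

theorem topVertex_mem_frontier {n : ℕ} (hn : 3 ≤ n) :
    topVertex n ∈ frontier (spikyBody (unitBall 3) (equatorAndTop n)) :=
  mem_frontier_of_inner_eq_one (inner_neg_tiltedDir_le_one hn 0)
    (by rw [inner_neg_left, inner_tiltedDir_topVertex hn, neg_neg])
    (subset_spikyBody _ (topVertex_mem n))

open Classical in
theorem card_illuminated_equatorVertex_le {n : ℕ} (hn : 3 ≤ n)
    (u : Metric.sphere (0 : EuclideanSpace ℝ (Fin 3)) 1) :
    ((Finset.Icc 1 n).filter fun i => Illuminates (spikyBody (unitBall 3) (equatorAndTop n)) u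
      (equatorVertex n i)).card ≤ (n - 1) / 2 := by
  have hc := cos_pi_div_pos hn
  let w : EuclideanSpace ℝ (Fin 3) := u
  have hg : ∀ x, inner ℝ (equatorDir n x) w =
      w 0 * Real.cos (x * (Real.pi / n)) + w 1 * Real.sin (x * (Real.pi / n)) := by
    intro x
    rw [inner_eq_three]
    simp [equatorDir]
    ring
  refine le_trans (Finset.card_le_card ?_) (card_consecutive_neg_le hn _ _ _ hg)
  refine Finset.monotone_filter_right _ fun i _ hi => ⟨?_, ?_⟩
  · have h := inner_equatorDir_le_one hn (i : ℤ)
    rw [Int.cast_natCast] at h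
    refine inner_neg_of_illuminates h ?_ hi
    rw [inner_equatorDir_equatorVertex, add_sub_cancel_left, one_mul, div_self hc.ne']
  · have h := inner_equatorDir_le_one hn ((i : ℤ) - 1)
    have e : (2 * (((i : ℤ) - 1 : ℤ) : ℝ) + 1) = 2 * i - 1 := by push_cast; ring
    rw [e] at h
    refine inner_neg_of_illuminates h ?_ hi
    rw [inner_equatorDir_equatorVertex, sub_sub_cancel_left, neg_one_mul, Real.cos_neg,
      div_self hc.ne']

theorem lower_bound {m n : ℕ} (hn : 3 ≤ n)
    {U : Multiset (Metric.sphere (0 : EuclideanSpace ℝ (Fin 3)) 1)}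
    (hU : IsMultiplyIlluminated m (spikyBody (unitBall 3) (equatorAndTop n)) U) :
    m * n + (n - 1) / 2 * m ≤ (n - 1) / 2 * Multiset.card U := by
  classical
  refine le_trans ?_ (sum_countP_add_mul_countP_le (Finset.Icc 1 n)
    (fun i u => Illuminates (spikyBody (unitBall 3) (equatorAndTop n)) u (equatorVertex n i))
    (fun u => Illuminates (spikyBody (unitBall 3) (equatorAndTop n)) u (topVertex n)) _
    (fun u => by convert card_illuminated_equatorVertex_le hn u)
    (fun u hu i _ => not_illuminates_equatorVertex_of_topVertex hn i hu) U)
  refine add_le_add ?_ (Nat.mul_le_mul_left _ ?_)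
  · have := Finset.card_nsmul_le_sum (Finset.Icc 1 n) (fun i => U.countP fun u =>
      Illuminates (spikyBody (unitBall 3) (equatorAndTop n)) u (equatorVertex n i)) m
      (fun i hi => by convert hU _ (equatorVertex_mem_frontier hn hi))
    simpa [mul_comm] using this
  · convert hU _ (topVertex_mem_frontier hn)

/-! ### Upper bound -/

/-- The direction with horizontal part of length `c` and angle `π + x * π / n`, and height `s`. -/
noncomputable def coneDir (n : ℕ) (c s : ℝ) (h : c ^ 2 + s ^ 2 = 1) (x : ℝ) :
    Metric.sphere (0 : EuclideanSpace ℝ (Fin 3)) 1 :=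
  ⟨!₂[-(c * Real.cos (x * (Real.pi / n))), -(c * Real.sin (x * (Real.pi / n))), s], by
    rw [mem_sphere_zero_iff_norm]
    apply norm_eq_one_of_sq
    simp
    linear_combination c ^ 2 * Real.cos_sq_add_sin_sq (x * (Real.pi / n)) + h⟩

/-- The direction pointing vertically down. -/
noncomputable def downDir : Metric.sphere (0 : EuclideanSpace ℝ (Fin 3)) 1 :=
  ⟨!₂[0, 0, -1], by
    rw [mem_sphere_zero_iff_norm]
    apply norm_eq_one_of_sq
    simp⟩

theorem inner_coneDir_equatorVertex {n : ℕ} {c s : ℝ} (h : c ^ 2 + s ^ 2 = 1) (x : ℝ) (i : ℕ) :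
    inner ℝ (coneDir n c s h x : EuclideanSpace ℝ (Fin 3)) (equatorVertex n i) =
      -(c * Real.cos ((x - 2 * i) * (Real.pi / n)) / Real.cos (Real.pi / n)) := by
  rw [inner_equatorVertex, sub_mul, Real.cos_sub]
  simp [coneDir]
  ring

/-- Since sin(π/n) = cos((n/2 - 1)π/n) and k < n/2, the inequality is strict at c = 1. This leaves
room for c < 1, hence for a positive vertical component. -/
theorem exists_cone_slope {n k : ℕ} (hn : 3 ≤ n) (hk : 0 < k) (hkn : 2 * k < n) :
    ∃ c s : ℝ, 0 < c ∧ 0 < s ∧ c ^ 2 + s ^ 2 = 1 ∧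
      Real.sin (Real.pi / n) < c * Real.cos ((k - 1) * (Real.pi / n)) := by
  have hp := pi_div_pos hn
  have hnpi : n * (Real.pi / n) = Real.pi := by field_simp
  have hk1 : (1 : ℝ) ≤ k := by exact_mod_cast hk
  have hkn' : 2 * (k : ℝ) < n := by exact_mod_cast hkn
  have hs := sin_pi_div_pos hn
  have hlt : Real.sin (Real.pi / n) < Real.cos ((k - 1) * (Real.pi / n)) := by
    rw [← Real.cos_pi_div_two_sub]
    refine Real.cos_lt_cos_of_nonneg_of_le_pi (by nlinarith) (by linarith [Real.pi_pos])
      (by nlinarith)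
  set A := Real.cos ((k - 1) * (Real.pi / n))
  set B := Real.sin (Real.pi / n)
  have hA : 0 < A := hs.trans hlt
  have hBA : B / A < 1 := (div_lt_one hA).2 hlt
  have hBA0 : 0 < B / A := div_pos hs hA
  refine ⟨(B / A + 1) / 2, √(1 - ((B / A + 1) / 2) ^ 2), by linarith,
    Real.sqrt_pos.2 (by nlinarith), ?_, ?_⟩
  · rw [Real.sq_sqrt (by nlinarith)]
    ring
  · rw [← div_lt_iff₀ hA]
    linarith

/-- The direction opposes the centre of block j, at angle (2jk + k - 1)π/n, and the l-th vertex of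
the block is k - 1 - 2l steps of π/n away, so at most k - 1. As ‖q‖² - 1 = tan²(π/n), `hcs` is the
required bound. -/
theorem illuminates_equatorVertex {n k : ℕ} (hn : 3 ≤ n) (hk : 0 < k) (hkn : 2 * k < n) {c s : ℝ}
    (h : c ^ 2 + s ^ 2 = 1) (hc : 0 < c)
    (hcs : Real.sin (Real.pi / n) < c * Real.cos ((k - 1) * (Real.pi / n)))
    {i j l : ℕ} (hi : i ∈ Finset.Icc 1 n) (hl : l < k) {z : ℤ}
    (hz : (i : ℤ) + z * n = j * k + l) :
    Illuminates (spikyBody (unitBall 3) (equatorAndTop n)) (coneDir n c s h (2 * (j * k) + k - 1))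
      (equatorVertex n i) := by
  have hp := pi_div_pos hn
  have hnpi : n * (Real.pi / n) = Real.pi := by field_simp
  have hcos := cos_pi_div_pos hn
  have hsin := sin_pi_div_pos hn
  have hk1 : (1 : ℝ) ≤ k := by exact_mod_cast hk
  have hkn' : 2 * (k : ℝ) < n := by exact_mod_cast hkn
  have hl' : (l : ℝ) + 1 ≤ k := by exact_mod_cast hl
  have hl0 : (0 : ℝ) ≤ l := l.cast_nonneg
  have hz' : (i : ℝ) + z * n = j * k + l := by exact_mod_cast hz
  have e : ((2 * (j * k) + k - 1 : ℝ) - 2 * i) * (Real.pi / n) =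
      (k - 1 - 2 * l) * (Real.pi / n) + z * (2 * Real.pi) := by
    linear_combination 2 * z * hnpi - 2 * (Real.pi / n) * hz'
  have hle : Real.cos ((k - 1) * (Real.pi / n)) ≤ Real.cos ((k - 1 - 2 * l) * (Real.pi / n)) := by
    refine cos_le_cos_of_abs_le ?_ (by nlinarith)
    rw [abs_mul, abs_of_pos hp]
    exact mul_le_mul_of_nonneg_right (abs_le.2 ⟨by linarith, by linarith⟩) hp.le
  have hlt : Real.sin (Real.pi / n) / Real.cos (Real.pi / n) <
      c * Real.cos ((k - 1 - 2 * l) * (Real.pi / n)) / Real.cos (Real.pi / n) :=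
    div_lt_div_of_pos_right (hcs.trans_le (mul_le_mul_of_nonneg_left hle hc.le)) hcos
  have h0 : 0 < Real.sin (Real.pi / n) / Real.cos (Real.pi / n) := div_pos hsin hcos
  have hsq : 1 / Real.cos (Real.pi / n) ^ 2 - 1 =
      (Real.sin (Real.pi / n) / Real.cos (Real.pi / n)) ^ 2 := by
    rw [div_pow, Real.sin_sq]
    field_simp
  apply illuminates_vertex (equatorVertex_mem hi)
  · rw [inner_coneDir_equatorVertex, e, Real.cos_add_int_mul_two_pi]
    linarith
  · rw [inner_coneDir_equatorVertex, e, Real.cos_add_int_mul_two_pi, norm_sq_equatorVertex, hsq,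
      neg_sq]
    exact pow_lt_pow_left₀ hlt h0.le two_ne_zero

/-- A vector of the closed lower half-space has a nearest vertex direction `i`, and every
direction whose block contains `i` makes an obtuse angle with the vector. -/
theorem exists_inner_coneDir_neg {n k : ℕ} (hn : 3 ≤ n) (hkn : 2 * k < n) {c s : ℝ}
    (h : c ^ 2 + s ^ 2 = 1) (hc : 0 < c) (hs : 0 < s) {b : EuclideanSpace ℝ (Fin 3)}
    (hb : b ≠ 0) (hb2 : b 2 ≤ 0) :
    ∃ i : ℤ, ∀ j l : ℕ, l < k → ∀ z : ℤ, i + z * n = j * k + l →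
      inner ℝ (coneDir n c s h (2 * (j * k) + k - 1) : EuclideanSpace ℝ (Fin 3)) b < 0 := by
  have hp := pi_div_pos hn
  have hnpi : n * (Real.pi / n) = Real.pi := by field_simp
  have hkn' : 2 * (k : ℝ) < n := by exact_mod_cast hkn
  obtain ⟨r, φ, hr, h0, h1⟩ : ∃ r φ : ℝ, 0 ≤ r ∧ b 0 = r * Real.cos (φ * (Real.pi / n)) ∧
      b 1 = r * Real.sin (φ * (Real.pi / n)) := by
    refine ⟨‖(⟨b 0, b 1⟩ : ℂ)‖, Complex.arg ⟨b 0, b 1⟩ / (Real.pi / n), norm_nonneg _, ?_, ?_⟩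
    · rw [div_mul_cancel₀ _ hp.ne', Complex.norm_mul_cos_arg]
    · rw [div_mul_cancel₀ _ hp.ne', Complex.norm_mul_sin_arg]
  -- Rounding costs at most one step of π/n on top of the k - 1 within a block; the total kπ/n is
  -- still below π/2.
  refine ⟨round (φ / 2), fun j l hl z hz => ?_⟩
  have hround := abs_le.1 (abs_sub_round (φ / 2))
  have hl' : (l : ℝ) + 1 ≤ k := by exact_mod_cast hl
  have hl0 : (0 : ℝ) ≤ l := l.cast_nonneg
  have hz' : (round (φ / 2) : ℝ) + z * n = j * k + l := by exact_mod_cast hz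
  have e : ((2 * (j * k) + k - 1 : ℝ) - φ) * (Real.pi / n) =
      (k - 1 - 2 * l - 2 * (φ / 2 - round (φ / 2))) * (Real.pi / n) + z * (2 * Real.pi) := by
    linear_combination 2 * z * hnpi - 2 * (Real.pi / n) * hz'
  have hcos : 0 < Real.cos ((2 * (j * k) + k - 1 - φ) * (Real.pi / n)) := by
    rw [e, Real.cos_add_int_mul_two_pi]
    exact Real.cos_pos_of_mem_Ioo ⟨by nlinarith, by nlinarith⟩
  have hinner : inner ℝ (coneDir n c s h (2 * (j * k) + k - 1) : EuclideanSpace ℝ (Fin 3)) b =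
      -(c * r * Real.cos ((2 * (j * k) + k - 1 - φ) * (Real.pi / n))) + s * b 2 := by
    rw [inner_eq_three, h0, h1, sub_mul _ φ, Real.cos_sub]
    simp [coneDir]
    ring
  rw [hinner]
  -- If the horizontal part vanishes, `b` points straight down and only the rise `s > 0` makes the
  -- product negative.
  rcases hr.eq_or_lt with rfl | hr
  · have : b 2 ≠ 0 := by
      intro h2
      apply hb
      ext i
      fin_cases i
      · simpa using h0
      · simpa using h1
      · exact h2
    have := mul_pos hs (neg_pos.2 (lt_of_le_of_ne hb2 this))
    linarith
  · have := mul_pos (mul_pos hc hr) hcos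
    nlinarith [mul_nonneg hs.le (neg_nonneg.2 hb2)]

theorem illuminates_topVertex {n : ℕ} (hn : 3 ≤ n) :
    Illuminates (spikyBody (unitBall 3) (equatorAndTop n)) downDir (topVertex n) := by
  have hs := sin_pi_div_pos hn
  have e : inner ℝ (downDir : EuclideanSpace ℝ (Fin 3)) (topVertex n) =
      -(1 / Real.sin (Real.pi / n)) := by
    rw [inner_topVertex hn]
    simp [downDir, neg_div]
  apply illuminates_vertex (topVertex_mem n)
  · rw [e]
    exact neg_neg_of_pos (one_div_pos.2 hs)
  · rw [e, topVertex_eq hn, norm_sq_eq_three]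
    simp

theorem exists_isMultiplyIlluminated {m n k N : ℕ} (hn : 3 ≤ n) (hk : 0 < k) (hkn : 2 * k < n)
    (hN : m * n ≤ k * N) :
    ∃ U : Multiset (Metric.sphere (0 : EuclideanSpace ℝ (Fin 3)) 1),
      IsMultiplyIlluminated m (spikyBody (unitBall 3) (equatorAndTop n)) U ∧
        Multiset.card U = m + N := by
  classical
  obtain ⟨c, s, hc, hs, h, hcs⟩ := exists_cone_slope hn hk hkn
  refine ⟨Multiset.replicate m downDir +
    (Multiset.range N).map fun j : ℕ => coneDir n c s h (2 * (j * k) + k - 1), ?_, by simp⟩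
  have hdown : ∀ p, Illuminates (spikyBody (unitBall 3) (equatorAndTop n)) downDir p →
      m ≤ Multiset.countP (fun u => Illuminates (spikyBody (unitBall 3) (equatorAndTop n)) u p)
        (Multiset.replicate m downDir +
          (Multiset.range N).map fun j : ℕ => coneDir n c s h (2 * (j * k) + k - 1)) := by
    intro p hp
    have hrep : Multiset.countP
        (fun u => Illuminates (spikyBody (unitBall 3) (equatorAndTop n)) u p)
        (Multiset.replicate m downDir) = m := by
      rw [Multiset.countP_eq_card.2, Multiset.card_replicate]
      intro u hu
      rwa [Multiset.eq_of_mem_replicate hu]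
    rw [Multiset.countP_add, hrep]
    exact Nat.le_add_right _ _
  have hcone : ∀ p (i : ℤ), (∀ j l : ℕ, l < k → ∀ z : ℤ, i + z * n = j * k + l →
      Illuminates (spikyBody (unitBall 3) (equatorAndTop n))
        (coneDir n c s h (2 * (j * k) + k - 1)) p) →
      m ≤ Multiset.countP (fun u => Illuminates (spikyBody (unitBall 3) (equatorAndTop n)) u p)
        (Multiset.replicate m downDir +
          (Multiset.range N).map fun j : ℕ => coneDir n c s h (2 * (j * k) + k - 1)) := by
    intro p i hi
    rw [Multiset.countP_add, Multiset.countP_map]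
    refine le_add_left ((le_card_blocks hk (by omega) hN i).trans ?_)
    refine Finset.card_le_card (t := (Finset.range N).filter fun j : ℕ =>
      Illuminates (spikyBody (unitBall 3) (equatorAndTop n))
        (coneDir n c s h (2 * (j * k) + k - 1)) p) ?_
    refine Finset.monotone_filter_right _ fun j _ hj => ?_
    obtain ⟨l, hl, z, hz⟩ := hj
    exact hi j l hl z hz
  intro p hp
  have key : m ≤ Multiset.countP
      (fun u => Illuminates (spikyBody (unitBall 3) (equatorAndTop n)) u p)
      (Multiset.replicate m downDir +
        (Multiset.range N).map fun j : ℕ => coneDir n c s h (2 * (j * k) + k - 1)) := by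
    rcases exists_of_mem_frontier_spikyBody (equatorAndTop_finite n) hp with
      (⟨i, h1, h2, rfl⟩ | rfl) | ⟨v, hv, b, hb, t, ht0, ht1, rfl⟩
    · exact hcone _ i fun j l hl z hz =>
        illuminates_equatorVertex hn hk hkn h hc hcs (Finset.mem_Icc.2 ⟨h1, h2⟩) hl hz
    · exact hdown _ (illuminates_topVertex hn)
    · rcases lt_or_ge 0 (b 2) with hb2 | hb2
      · refine hdown _ (illuminates_of_inner_neg hv hb ht0 ht1 ?_)
        rw [inner_eq_three]
        simpa [downDir] using hb2
      · obtain ⟨i, hi⟩ := exists_inner_coneDir_neg hn hkn h hc hs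
          (b := b) (by rintro rfl; simp at hb) hb2
        exact hcone _ i fun j l hl z hz =>
          illuminates_of_inner_neg hv hb ht0 ht1 (hi j l hl z hz)
  convert key

/-! ### Matching the bounds -/

theorem mainTheorem10 (m n : ℕ) (hm : 1 ≤ m) (hn : 3 ≤ n) :
    IsCapBodyVertexSet (unitBall 3) (equatorAndTop n) ∧
      multipleIlluminationNumber m (spikyBody (unitBall 3) (equatorAndTop n)) =
        ((m + ⌈((m : ℝ) * n) / (⌊((n : ℝ) - 1) / 2⌋₊ : ℝ)⌉₊ : ℕ) : ℕ∞) := by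
  refine ⟨isCapBodyVertexSet_equatorAndTop hn, ?_⟩
  have hfloor : ⌊((n : ℝ) - 1) / 2⌋₊ = (n - 1) / 2 := by
    rw [← Nat.cast_pred (by omega), Nat.floor_div_ofNat, Nat.floor_natCast]
  rw [hfloor]
  have hk : 0 < (n - 1) / 2 := by omega
  have hkn : 2 * ((n - 1) / 2) < n := by omega
  generalize hk' : (n - 1) / 2 = k at hk hkn ⊢
  have hk0 : (0 : ℝ) < k := by exact_mod_cast hk
  have hceil : ∀ N : ℕ, ⌈((m : ℝ) * n) / k⌉₊ ≤ N ↔ m * n ≤ k * N := by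
    intro N
    rw [Nat.ceil_le, div_le_iff₀ hk0, mul_comm (N : ℝ)]
    exact_mod_cast Iff.rfl
  apply le_antisymm
  · obtain ⟨U, hU, hcard⟩ := exists_isMultiplyIlluminated hn hk hkn ((hceil _).1 le_rfl)
    exact sInf_le ⟨U, hU, by rw [hcard]⟩
  · refine le_sInf ?_
    rintro _ ⟨U, hU, rfl⟩
    have hlow := lower_bound hn hU
    rw [hk'] at hlow
    -- This permits writing |U| = m + N, after which the lower bound becomes mn ≤ kN.
    have hmU : m ≤ Multiset.card U := Nat.le_of_mul_le_mul_left (by omega) hk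
    obtain ⟨N, hN⟩ := Nat.exists_eq_add_of_le hmU
    rw [hN] at hlow ⊢
    have : ⌈((m : ℝ) * n) / k⌉₊ ≤ N := (hceil N).2 (by rw [mul_add] at hlow; omega)
    exact_mod_cast Nat.add_le_add_left this m
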